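/- Let $\mathbb{S}^1=\mathbb{R}/2\pi\mathbb{Z}$ with geodesic distance $d_{\mathrm{geo}}(x,y)=\min_{k\in\mathbb{Z}}|x-y+2\pi k|$. Let $\mathcal{A}=C^\infty(\mathbb{S}^1)$ act by pointwise multiplication on $\mathcal{H}=L^2(\mathbb{S}^1,\tfrac{dx}{2\pi})$, let $D=-i\,\tfrac{d}{dx}$ be the self-adjoint operator with domain $H^1(\mathbb{S}^1)$, and let $e_n(x)=e^{inx}$, $n\in\mathbb{Z}$. For $N\in\mathbb{N}$ let $P_N$ be the orthogonal projection onto $\mathrm{Span}\{e_n:|n|\le N\}$, let $D_N=P_NDP_N$, $\pi_N(a)=P_NaP_N$, and $\mathcal{O}_N=\pi_N(\mathcal{A}^{\mathrm{sa}})$, an order unit space with order unit $P_N$. A state of $\mathcal{O}_N$ (resp. of $\mathcal{A}$) is a positive linear functional on $\mathcal{O}_N$ (resp. $\mathcal{A}^{\mathrm{sa}}$) with value $1$ at the order unit $P_N$ (resp. $1$); for a state $\varphi$ of $\mathcal{O}_N$ let $\varphi^\sharp=\varphi\circ\pi_N$, a state of $\mathcal{A}$. Define, with values in $[0,\infty]$,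 $$d^\flat_{\mathcal{A},D}(\varphi,\varphi')=\sup\{\varphi^\sharp(a)-\varphi'^\sharp(a): a\in\mathcal{A}^{\mathrm{sa}},\ \|[D,a]\|\le 1\},$$ $$d_{\mathcal{O}_N,D_N}(\varphi,\varphi')=\sup\{\varphi(b)-\varphi'(b): b\in\mathcal{O}_N,\ \|[D_N,b]\|\le 1\}.$$ For $x\in\mathbb{R}$ let $\Psi_{x,N}(b)=\langle\psi_{x,N},b\,\psi_{x,N}\rangle$ be the vector state of $\mathcal{O}_N$ given by $\psi_{x,N}=\frac{1}{\sqrt{N+1}}\sum_{n=0}^N e^{-inx}e_n$; it depends only on the class of $x$ in $\mathbb{S}^1$. Then for all $x,y\in\mathbb{R}$ (viewed as points of $\mathbb{S}^1$ where appropriate): (0) For all $N\in\mathbb{N}$ and all real-valued $f\in C^\infty(\mathbb{S}^1)$, with Fourier coefficients $f_n=\frac1{2\pi}\int_{-\pi}^{\pi}f(t)e^{-int}\,dt$, $$\Psi_{x,N}^\sharp(f)=\sum_{n=-N}^N\Big(1-\frac{|n|}{N+1}\Big)f_n\,e^{inx},$$ the Fejér transform of $f$ evaluated at $x$. (i) For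 all $N\in\mathbb{N}$, $$d^\flat_{\mathcal{A},D}(\Psi_{x,N},\Psi_{y,N})\le d_{\mathcal{O}_N,D_N}(\Psi_{x,N},\Psi_{y,N})\le d_{\mathrm{geo}}(x,y),$$ and $$\lim_{N\to\infty}d^\flat_{\mathcal{A},D}(\Psi_{x,N},\Psi_{y,N})=\lim_{N\to\infty}d_{\mathcal{O}_N,D_N}(\Psi_{x,N},\Psi_{y,N})=d_{\mathrm{geo}}(x,y).$$ (ii) For all $N\in\mathbb{N}$, $\rho_N(x-y)\le d^\flat_{\mathcal{A},D}(\Psi_{x,N},\Psi_{y,N})\le\rho'_N(x-y)$, where for $z\in\mathbb{R}$ $$\rho_N(z)=\frac{8}{\pi}\sum_{\substack{1\le n\le N\\ n\ \mathrm{odd}}}\frac{(-1)^{(n-1)/2}}{n^2}\Big(1-\frac{n}{N+1}\Big)\sin\frac{nz}{2},\qquad \rho'_N(z)=2\sqrt2\,\sqrt{\sum_{1\le n\le N}\frac{1}{n^2}\Big(1-\frac{n}{N+1}\Big)^2\Big(\sin\frac{nz}{2}\Big)^2}.$$ -/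

import Mathlib

open scoped Real ENNReal NNReal InnerProductSpace

noncomputable section

namespace SpectralCutoff

/-! ### Order unit spaces of operators, their states, and the distances dual to seminorms -/

section General

variable {H : Type*} [NormedAddCommGroup H] [InnerProductSpace ℂ H]

/-- The operator norm `‖[D, a]‖ ∈ [0, ∞]` of the commutator of a (possibly unbounded) operator `D`
with a bounded operator `a`: the least `c` such that `a` maps the domain of `D` into itself and
`‖D a ψ - a D ψ‖ ≤ c ‖ψ‖` for all `ψ` in that domain (and `∞` if there is no such `c`). -/
def commNorm (D : H →ₗ.[ℂ] H) (a : H →L[ℂ] H) : ℝ≥0∞ :=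
  ⨅ c : ℝ≥0, ⨅ _ : ∀ ψ : D.domain, ∃ h : a ψ ∈ D.domain,
    ‖D ⟨a ψ, h⟩ - a (D ψ)‖ ≤ c * ‖(ψ : H)‖, (c : ℝ≥0∞)

/-- The truncated operator `P D P`, on its natural domain `{ψ | P ψ ∈ Dom D}`. -/
def truncOp (P : H →L[ℂ] H) (D : H →ₗ.[ℂ] H) : H →ₗ.[ℂ] H where
  domain := D.domain.comap (P : H →ₗ[ℂ] H)
  toFun := (P : H →ₗ[ℂ] H) ∘ₗ D.toFun ∘ₗ
    (P : H →ₗ[ℂ] H).restrict (p := D.domain.comap (P : H →ₗ[ℂ] H)) (q := D.domain)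
      (fun _ hψ => hψ)

/-- The map `a ↦ P a P` on bounded operators. -/
def compress (P : H →L[ℂ] H) : (H →L[ℂ] H) →ₗ[ℝ] (H →L[ℂ] H) where
  toFun a := P ∘L a ∘L P
  map_add' a b := by ext ψ; simp
  map_smul' r a := by
    ext ψ
    simp [ContinuousLinearMap.comp_apply]

/-- A state of a real vector space `O` of bounded operators with order unit `e`: a real linear
functional that is positive (for the operator order) and takes the value `1` at `e`. Applied to the
self-adjoint part of a unital `*`-algebra of operators, these are the states of the algebra. -/
structure OUState (O : Submodule ℝ (H →L[ℂ] H)) (e : O) where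
  /-- the underlying linear functional -/
  toLin : O →ₗ[ℝ] ℝ
  nonneg' : ∀ a : O, (a : H →L[ℂ] H).IsPositive → 0 ≤ toLin a
  unit' : toLin e = 1

/-- The extended distance between states that is dual to a seminorm `L`:
`sup {φ(a) - φ'(a) | a ∈ O, L(a) ≤ 1}`. -/
def stateDist (L : (H →L[ℂ] H) → ℝ≥0∞) {O : Submodule ℝ (H →L[ℂ] H)} {e : O}
    (φ φ' : OUState O e) : EReal :=
  ⨆ a : O, ⨆ _ : L (a : H →L[ℂ] H) ≤ 1, ((φ.toLin a - φ'.toLin a : ℝ) : EReal)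

/-- The space `π_P(O) = P O P`, image of `O` under `a ↦ P a P`. -/
def truncSpace (P : H →L[ℂ] H) (O : Submodule ℝ (H →L[ℂ] H)) : Submodule ℝ (H →L[ℂ] H) :=
  O.map (compress P)

/-- `a ↦ P a P` as a linear map from `O` onto `P O P`. -/
def truncMap (P : H →L[ℂ] H) (O : Submodule ℝ (H →L[ℂ] H)) : O →ₗ[ℝ] truncSpace P O :=
  (compress P).restrict (fun _ ha => Submodule.mem_map_of_mem ha)

variable [CompleteSpace H]

/-- The self-adjoint part of a `*`-algebra of operators. -/
def saPart (A : StarSubalgebra ℂ (H →L[ℂ] H)) : Submodule ℝ (H →L[ℂ] H) where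
  carrier := {a | a ∈ A ∧ IsSelfAdjoint a}
  add_mem' := fun ha hb => ⟨A.add_mem ha.1 hb.1, ha.2.add hb.2⟩
  zero_mem' := ⟨A.zero_mem, IsSelfAdjoint.zero _⟩
  smul_mem' := fun r a ha => by
    refine ⟨?_, (IsSelfAdjoint.all r).smul ha.2⟩
    have h := A.smul_mem ha.1 (r : ℂ)
    rwa [Complex.coe_smul] at h

/-- The order unit `1` of the self-adjoint part. -/
def saOne (A : StarSubalgebra ℂ (H →L[ℂ] H)) : saPart A :=
  ⟨1, A.one_mem, IsSelfAdjoint.one _⟩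

/-- The pull back `φ ↦ φ^♯ = φ ∘ π_P` of states of `P O P` (with order unit `P e P`) to states of
`O`, for an orthogonal projection (more generally, a self-adjoint operator) `P`. -/
def OUState.sharp {P : H →L[ℂ] H} (hP : IsSelfAdjoint P) {O : Submodule ℝ (H →L[ℂ] H)} {e : O}
    (φ : OUState (truncSpace P O) (truncMap P O e)) : OUState O e where
  toLin := φ.toLin ∘ₗ truncMap P O
  nonneg' a ha := by
    refine φ.nonneg' _ ?_
    have h := ha.conj_adjoint P
    rw [ContinuousLinearMap.isSelfAdjoint_iff'.1 hP] at h
    exact h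
  unit' := φ.unit'

/-- The vector state `b ↦ ⟨ψ, b ψ⟩` on `P A^sa P`, for a unit vector `ψ` in the range of the
projection `P`. -/
def vectorState {P : H →L[ℂ] H} (A : StarSubalgebra ℂ (H →L[ℂ] H)) (ψ : H) (hψ : P ψ = ψ)
    (hn : ‖ψ‖ = 1) : OUState (truncSpace P (saPart A)) (truncMap P (saPart A) (saOne A)) where
  toLin :=
    { toFun := fun b => (⟪ψ, (b : H →L[ℂ] H) ψ⟫_ℂ).re
      map_add' := fun a b => by simp
      map_smul' := fun r a => by
        simp }
  nonneg' a ha := by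
    have := ha.re_inner_nonneg_right ψ
    simpa using this
  unit' := by
    change (⟪ψ, P ((1 : H →L[ℂ] H) (P ψ))⟫_ℂ).re = 1
    simp [hψ, inner_self_eq_norm_sq_to_K, hn]

end General

/-! ### The spectral triple of the circle -/

instance fact_two_pi_pos : Fact (0 < 2 * π) := ⟨Real.two_pi_pos⟩

/-- The circle `ℝ / 2πℤ`, with its quotient metric (the geodesic distance). -/
abbrev S1 : Type := AddCircle (2 * π)

/-- `L²(S¹, dx/2π)`. -/
abbrev L2S1 : Type := MeasureTheory.Lp ℂ 2 (AddCircle.haarAddCircle (T := 2 * π))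

/-- A continuous function as an element of `L²`. -/
def toL2 : C(S1, ℂ) →L[ℂ] L2S1 := ContinuousMap.toLp 2 AddCircle.haarAddCircle ℂ

/-- Smooth functions on the circle, i.e. functions with smooth `2π`-periodic lift. -/
def smoothFun : StarSubalgebra ℂ C(S1, ℂ) where
  carrier := {f | ContDiff ℝ (⊤ : ℕ∞) (fun t : ℝ => f (t : S1))}
  mul_mem' {f g} hf hg := by
    simp only [Set.mem_ofPred_eq, ContinuousMap.mul_apply] at hf hg ⊢
    exact ContDiff.mul hf hg
  one_mem' := by
    simp only [Set.mem_ofPred_eq, ContinuousMap.one_apply]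
    exact contDiff_const
  add_mem' {f g} hf hg := by
    simp only [Set.mem_ofPred_eq, ContinuousMap.add_apply] at hf hg ⊢
    exact ContDiff.add hf hg
  zero_mem' := by
    simp only [Set.mem_ofPred_eq, ContinuousMap.zero_apply]
    exact contDiff_const
  algebraMap_mem' c := by
    simp only [Algebra.algebraMap_eq_smul_one, Set.mem_ofPred_eq, ContinuousMap.smul_apply,
      ContinuousMap.one_apply]
    exact contDiff_const
  star_mem' {f} hf := by
    simp only [Set.mem_ofPred_eq, ContinuousMap.star_apply] at hf ⊢
    exact Complex.conjCLE.contDiff.comp hf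

/-- Multiplication by a continuous function, as a bounded operator on `L²`. -/
def mulL (f : C(S1, ℂ)) : L2S1 →L[ℂ] L2S1 :=
  (ContinuousLinearMap.mul ℂ ℂ).holderL AddCircle.haarAddCircle ∞ 2 2
    (ContinuousMap.toLp ∞ AddCircle.haarAddCircle ℂ f)

lemma coeFn_mulL (f : C(S1, ℂ)) (ψ : L2S1) :
    mulL f ψ =ᵐ[AddCircle.haarAddCircle] fun x => f x * ψ x := by
  have h1 := ContinuousLinearMap.coeFn_holder (r := 2) (ContinuousLinearMap.mul ℂ ℂ)
    (ContinuousMap.toLp ∞ AddCircle.haarAddCircle ℂ f) ψ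
  have h2 := ContinuousMap.coeFn_toLp (p := ∞) (𝕜 := ℂ)
    (AddCircle.haarAddCircle (T := 2 * π)) f
  filter_upwards [h1, h2] with x hx hx'
  rw [← hx']
  exact hx

/-- The representation of continuous functions by multiplication operators on `L²`. -/
def mulRep : C(S1, ℂ) →⋆ₐ[ℂ] (L2S1 →L[ℂ] L2S1) where
  toFun := mulL
  map_one' := by
    ext1 ψ
    refine MeasureTheory.Lp.ext ?_
    filter_upwards [coeFn_mulL 1 ψ] with x hx
    simp [hx]
  map_mul' f g := by
    ext1 ψ
    refine MeasureTheory.Lp.ext ?_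
    filter_upwards [coeFn_mulL (f * g) ψ, coeFn_mulL f (mulL g ψ), coeFn_mulL g ψ]
      with x h1 h2 h3
    rw [h1]
    refine Eq.trans ?_ h2.symm
    rw [h3]
    simp [mul_assoc]
  map_zero' := by simp [mulL]
  map_add' f g := by simp [mulL]
  commutes' c := by
    ext1 ψ
    refine MeasureTheory.Lp.ext ?_
    filter_upwards [coeFn_mulL (algebraMap ℂ C(S1, ℂ) c) ψ, MeasureTheory.Lp.coeFn_smul c ψ]
      with x h1 h2
    rw [h1, ContinuousLinearMap.algebraMap_apply, h2]
    simp
  map_star' f := by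
    rw [ContinuousLinearMap.star_eq_adjoint, ContinuousLinearMap.eq_adjoint_iff]
    intro ψ η
    rw [MeasureTheory.L2.inner_def, MeasureTheory.L2.inner_def]
    refine MeasureTheory.integral_congr_ae ?_
    filter_upwards [coeFn_mulL (star f) ψ, coeFn_mulL f η] with x h1 h2
    rw [h1, h2]
    simp [RCLike.inner_apply]
    ring

/-- The `*`-algebra `C^∞(S¹)`, acting on `L²(S¹)` by pointwise multiplication. -/
def circleAlg : StarSubalgebra ℂ (L2S1 →L[ℂ] L2S1) := smoothFun.map mulRep

/-- The graph of the self-adjoint operator `-i d/dx` on `L²(S¹)`: the pairs `(ψ, η)` such that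
`η = -i ψ'` weakly, i.e. `⟨g, η⟩ = ⟨-i g', ψ⟩` for all smooth `g`. -/
def diracGraph : Submodule ℂ (L2S1 × L2S1) where
  carrier := {p | ∀ g g' : C(S1, ℂ), g ∈ smoothFun →
    (∀ t : ℝ, HasDerivAt (fun s : ℝ => g (s : S1)) (g' (t : S1)) t) →
    ⟪toL2 g, p.2⟫_ℂ = ⟪(-Complex.I) • toL2 g', p.1⟫_ℂ}
  add_mem' := fun hp hq g g' hg hg' => by
    simp only [Prod.fst_add, Prod.snd_add, inner_add_right, hp g g' hg hg', hq g g' hg hg']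
  zero_mem' := fun g g' _ _ => by simp
  smul_mem' := fun c p hp g g' hg hg' => by
    simp only [Prod.smul_fst, Prod.smul_snd, inner_smul_right, hp g g' hg hg']

lemma fourier_mem_smoothFun (n : ℤ) : (fourier n : C(S1, ℂ)) ∈ smoothFun := by
  have h : (fun t : ℝ => fourier n (t : S1)) =
      fun t : ℝ => Complex.exp (2 * π * Complex.I * n * t / ((2 * π : ℝ) : ℂ)) :=
    funext fun t => fourier_coe_apply
  change ContDiff ℝ (⊤ : ℕ∞) (fun t : ℝ => fourier n (t : S1))
  rw [h]
  exact (((contDiff_const.mul Complex.ofRealCLM.contDiff).div_const _)).cexp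

/-- Weak derivatives are unique, so `diracGraph` is the graph of an operator. -/
lemma diracGraph_single (p : L2S1 × L2S1) (hp : p ∈ diracGraph) (h0 : p.1 = 0) : p.2 = 0 := by
  have key : ∀ n : ℤ, ⟪(fourierLp 2 n : L2S1), p.2⟫_ℂ = 0 := by
    intro n
    have h := hp (fourier n) ((2 * π * Complex.I * n / ((2 * π : ℝ) : ℂ)) • fourier n)
      (fourier_mem_smoothFun n) (fun t => hasDerivAt_fourier (2 * π) n t)
    rw [h0, inner_zero_right] at h
    exact h
  refine (fourierBasis (T := 2 * π)).repr.injective ?_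
  rw [map_zero]
  ext n
  rw [HilbertBasis.repr_apply_apply, coe_fourierBasis, key n]
  rfl

/-- The Dirac operator `D = -i d/dx` of the circle, with domain the Sobolev space `H¹(S¹)`. -/
def circleD : L2S1 →ₗ.[ℂ] L2S1 := diracGraph.toLinearPMap

/-- `H_N`, the span of the Fourier modes `e_n`, `|n| ≤ N`. -/
def fourierSpan (N : ℕ) : Submodule ℂ L2S1 :=
  Submodule.span ℂ ((fun n : ℤ => (fourierLp 2 n : L2S1)) '' Set.Icc (-(N : ℤ)) N)

instance fourierSpan_finiteDimensional (N : ℕ) : FiniteDimensional ℂ (fourierSpan N) :=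
  FiniteDimensional.span_of_finite ℂ ((Set.finite_Icc _ _).image _)

/-- The orthogonal projection `P_N` onto `H_N`. -/
def projN (N : ℕ) : L2S1 →L[ℂ] L2S1 := (fourierSpan N).starProjection

lemma projN_isSelfAdjoint (N : ℕ) : IsSelfAdjoint (projN N) :=
  isSelfAdjoint_starProjection (fourierSpan N)

/-- The truncated Dirac operator `D_N = P_N D P_N`. -/
def circleDN (N : ℕ) : L2S1 →ₗ.[ℂ] L2S1 := truncOp (projN N) circleD

/-- The order unit space `O_N = P_N A^sa P_N`. -/
abbrev circleO (N : ℕ) : Submodule ℝ (L2S1 →L[ℂ] L2S1) := truncSpace (projN N) (saPart circleAlg)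

/-- The order unit `P_N = P_N 1 P_N` of `O_N`. -/
abbrev circleOUnit (N : ℕ) : circleO N := truncMap (projN N) (saPart circleAlg) (saOne circleAlg)

/-- The vector `ψ_{x,N} = (N+1)^{-1/2} ∑_{n=0}^N e^{-inx} e_n`. -/
def fejerVec (x : S1) (N : ℕ) : L2S1 :=
  ((1 / √((N : ℝ) + 1) : ℝ) : ℂ) •
    ∑ n ∈ Finset.range (N + 1), fourier (-(n : ℤ)) x • (fourierLp 2 (n : ℤ) : L2S1)

lemma projN_fejerVec (x : S1) (N : ℕ) : projN N (fejerVec x N) = fejerVec x N := by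
  refine Submodule.starProjection_eq_self_iff.2 ?_
  refine Submodule.smul_mem _ _ (Submodule.sum_mem _ fun n hn => Submodule.smul_mem _ _ ?_)
  refine Submodule.subset_span ⟨n, ?_, rfl⟩
  have := Finset.mem_range.1 hn
  constructor <;> omega

lemma norm_fejerVec (x : S1) (N : ℕ) : ‖fejerVec x N‖ = 1 := by
  have ho : Orthonormal ℂ (fun n : ℕ => (fourierLp 2 (n : ℤ) : L2S1)) :=
    (orthonormal_fourier (T := 2 * π)).comp (fun n : ℕ => (n : ℤ)) Nat.cast_injective
  have h1 : ‖∑ n ∈ Finset.range (N + 1),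
      fourier (-(n : ℤ)) x • (fourierLp 2 (n : ℤ) : L2S1)‖ ^ 2 = (N : ℝ) + 1 := by
    have h := ho.inner_sum (fun n : ℕ => fourier (-(n : ℤ)) x)
      (fun n : ℕ => fourier (-(n : ℤ)) x) (Finset.range (N + 1))
    have h2 : ∀ n : ℕ, (starRingEnd ℂ) (fourier (-(n : ℤ)) x) * fourier (-(n : ℤ)) x = 1 := by
      intro n
      rw [mul_comm, Complex.mul_conj, Complex.normSq_eq_norm_sq]
      have : ‖fourier (-(n : ℤ)) x‖ = 1 := by rw [fourier_apply]; exact Circle.norm_coe _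
      rw [this]; simp
    rw [inner_self_eq_norm_sq_to_K] at h
    simp only [h2] at h
    simp only [Finset.sum_const, Finset.card_range, nsmul_eq_mul, mul_one] at h
    refine Complex.ofReal_injective ?_
    push_cast at h ⊢
    exact h
  have hpos : (0 : ℝ) < (N : ℝ) + 1 := by positivity
  have h3 : ‖fejerVec x N‖ ^ 2 = 1 := by
    rw [fejerVec, norm_smul, mul_pow, h1, Complex.norm_real, Real.norm_eq_abs, sq_abs, div_pow,
      Real.sq_sqrt hpos.le]
    field_simp
  have := norm_nonneg (fejerVec x N)
  nlinarith

/-- The state `Ψ_{x,N}` of `O_N`: the vector state of `ψ_{x,N}`. -/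
def fejerState (x : S1) (N : ℕ) : OUState (circleO N) (circleOUnit N) :=
  vectorState circleAlg (fejerVec x N) (projN_fejerVec x N) (norm_fejerVec x N)

/-- The state `φ^♯ = φ ∘ π_N` of `C^∞(S¹)`, for a state `φ` of `O_N`. -/
def circleSharp {N : ℕ} (φ : OUState (circleO N) (circleOUnit N)) :
    OUState (saPart circleAlg) (saOne circleAlg) :=
  φ.sharp (projN_isSelfAdjoint N)

/-- The spectral distance `d_{A,D}` on states of `A = C^∞(S¹)`. -/
def distAD (φ φ' : OUState (saPart circleAlg) (saOne circleAlg)) : EReal :=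
  stateDist (commNorm circleD) φ φ'

/-- The distance `d^♭_{A,D}(φ, φ') = d_{A,D}(φ^♯, φ'^♯)` on states of `O_N`. -/
def distFlat {N : ℕ} (φ φ' : OUState (circleO N) (circleOUnit N)) : EReal :=
  distAD (circleSharp φ) (circleSharp φ')

/-- The distance `d_{O_N,D_N}` on states of `O_N`, dual to the seminorm `‖[D_N, ·]‖`. -/
def distON {N : ℕ} (φ φ' : OUState (circleO N) (circleOUnit N)) : EReal :=
  stateDist (commNorm (circleDN N)) φ φ'

/-- The lower bound `ρ_N`. -/
def rhoLower (N : ℕ) (z : ℝ) : ℝ :=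
  8 / π * ∑ n ∈ (Finset.Icc 1 N).filter Odd,
    (-1 : ℝ) ^ ((n - 1) / 2) / (n : ℝ) ^ 2 * (1 - (n : ℝ) / ((N : ℝ) + 1)) *
      Real.sin ((n : ℝ) * z / 2)

/-- The upper bound `ρ'_N`. -/
def rhoUpper (N : ℕ) (z : ℝ) : ℝ :=
  2 * √2 * √(∑ n ∈ Finset.Icc 1 N,
    1 / (n : ℝ) ^ 2 * (1 - (n : ℝ) / ((N : ℝ) + 1)) ^ 2 * Real.sin ((n : ℝ) * z / 2) ^ 2)

/-- The `N`-th Fejér transform of `f`, evaluated at `x`: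
`∑_{|n| ≤ N} (1 - |n|/(N+1)) f_n e^{inx}`. -/
def fejerTransform (N : ℕ) (f : C(S1, ℂ)) (x : S1) : ℂ :=
  ∑ n ∈ Finset.Icc (-(N : ℤ)) N,
    ((1 - |(n : ℝ)| / ((N : ℝ) + 1) : ℝ) : ℂ) * fourierCoeff (f : S1 → ℂ) n * fourier n x

end SpectralCutoff

end

open SpectralCutoff

/-!
Everything rests on two descriptions of the functional `a ↦ ⟨ψ_x, a ψ_x⟩`, where `ψ_x` is
`fejerVec x N`.

For a multiplication operator it is a Toeplitz double sum, and collecting the diagonals turns it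
into the Fejér transform (`inner_fejerVec_mulL`). This is valid for every continuous function, so
Fejér transforms are contractions for the sup norm. As they commute with translations, they
preserve `1`-Lipschitz functions (`lipschitzWith_fejerPoly`), and they converge pointwise to the
identity (`tendsto_fejerTransform`).

On the other hand `ψ_x` is the translate of `ψ_0` under the group generated by `-i D`, so that for
`b` in `O_N` the derivative of `x ↦ ⟨ψ_x, b ψ_x⟩` is `i ⟨ψ_x, [D_N, b] ψ_x⟩`. Hence `‖[D_N, b]‖ ≤
1` makes this function `1`-Lipschitz, which gives the upper bound by the geodesic distance
(`distON_le_dist`). Since `P_N` commutes with `D`, truncation does not increase the commutator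
norm, and the distance for `D` is at most the distance for `D_N` (`distFlat_le_distON`).

For lower bounds, the Fejér means of a real `1`-Lipschitz function `f` are trigonometric
polynomials whose commutator with `D` has norm at most `1`, so the increment of the Fejér
transform of `f` bounds the distance from below (`fejerTransform_sub_le_distFlat`). Taking for `f`
the geodesic distance to `y` yields the limits; taking the distance to a point at a quarter turn
from the midpoint of `x` and `y` yields `rhoLower`, by the Fourier series of the triangle wave.

Finally, the commutator norm of `f` dominates the `L²` norm of `f'`, as one sees by applying the
commutator to the constant function `1`. The bound `rhoUpper` follows by the Cauchy–Schwarz and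
Bessel inequalities applied to the Fejér transform (`fejerTransform_sub_le_rhoUpper`).
-/

namespace SpectralCutoff

/-! ### The commutator seminorm -/

section General

variable {H : Type*} [NormedAddCommGroup H] [InnerProductSpace ℂ H]

/-- The infimum defining `commNorm` is attained. -/
lemma commNorm_le_one_iff {D : H →ₗ.[ℂ] H} {a : H →L[ℂ] H} :
    commNorm D a ≤ 1 ↔
      ∀ ψ : D.domain, ∃ h : a ψ ∈ D.domain, ‖D ⟨a ψ, h⟩ - a (D ψ)‖ ≤ ‖(ψ : H)‖ := by
  constructor
  · intro hc ψ
    have key : ∀ r : ℝ≥0, 1 < r →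
        ∃ h : a ψ ∈ D.domain, ‖D ⟨a ψ, h⟩ - a (D ψ)‖ ≤ r * ‖(ψ : H)‖ := by
      intro r hr
      have hlt : commNorm D a < (r : ℝ≥0∞) := hc.trans_lt (by exact_mod_cast hr)
      simp only [commNorm, iInf_lt_iff] at hlt
      obtain ⟨c, hcψ, hcr⟩ := hlt
      obtain ⟨h, hle⟩ := hcψ ψ
      have hcr' : (c : ℝ) ≤ r := by exact_mod_cast hcr.le
      exact ⟨h, hle.trans (mul_le_mul_of_nonneg_right hcr' (norm_nonneg _))⟩
    obtain ⟨h, -⟩ := key 2 (by norm_num)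
    refine ⟨h, ?_⟩
    have hlim : Filter.Tendsto (fun r : ℝ => r * ‖(ψ : H)‖) (nhdsWithin 1 (Set.Ioi 1))
        (nhds (1 * ‖(ψ : H)‖)) :=
      ((continuous_id.mul continuous_const).tendsto 1).mono_left nhdsWithin_le_nhds
    rw [one_mul] at hlim
    refine ge_of_tendsto hlim ?_
    filter_upwards [self_mem_nhdsWithin] with r hr
    have hr' : (1 : ℝ) < r := hr
    obtain ⟨_, hle⟩ := key ⟨r, zero_le_one.trans hr'.le⟩ hr'
    exact hle
  · intro h
    refine iInf₂_le_of_le 1 (fun ψ => ?_) (by simp)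
    simpa using h ψ

lemma stateDist_le_of_forall {L : (H →L[ℂ] H) → ℝ≥0∞} {O : Submodule ℝ (H →L[ℂ] H)} {e : O}
    {φ φ' : OUState O e} {r : ℝ}
    (h : ∀ a : O, L (a : H →L[ℂ] H) ≤ 1 → φ.toLin a - φ'.toLin a ≤ r) :
    stateDist L φ φ' ≤ (r : EReal) :=
  iSup₂_le fun a ha => EReal.coe_le_coe_iff.2 (h a ha)

lemma le_stateDist {L : (H →L[ℂ] H) → ℝ≥0∞} {O : Submodule ℝ (H →L[ℂ] H)} {e : O}
    (φ φ' : OUState O e) (a : O) (ha : L (a : H →L[ℂ] H) ≤ 1) :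
    ((φ.toLin a - φ'.toLin a : ℝ) : EReal) ≤ stateDist L φ φ' :=
  le_iSup₂_of_le a ha le_rfl

end General

/-! ### The Dirac operator in the Fourier basis -/

lemma circleD_graph : circleD.graph = diracGraph :=
  Submodule.toLinearPMap_graph_eq _ fun p hp h0 => diracGraph_single p hp h0

lemma mem_diracGraph (ψ : circleD.domain) : ((ψ : L2S1), circleD ψ) ∈ diracGraph := by
  rw [← circleD_graph]
  exact circleD.mem_graph ψ

lemma exists_circleD_eq {ψ η : L2S1} (h : (ψ, η) ∈ diracGraph) :
    ∃ hψ : ψ ∈ circleD.domain, circleD ⟨ψ, hψ⟩ = η := by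
  rw [← circleD_graph, LinearPMap.mem_graph_iff] at h
  obtain ⟨y, hy, hy'⟩ := h
  obtain ⟨y, hm⟩ := y
  obtain rfl : y = ψ := hy
  exact ⟨hm, hy'⟩

lemma inner_fourierLp_toL2 (f : C(S1, ℂ)) (n : ℤ) :
    ⟪(fourierLp 2 n : L2S1), toL2 f⟫_ℂ = fourierCoeff (f : S1 → ℂ) n := by
  have h := fourierBasis.repr_apply_apply (toL2 f) n
  rw [coe_fourierBasis] at h
  rw [← h, fourierBasis_repr]
  exact fourierCoeff_toLp f n

lemma inner_toL2_fourierLp (f : C(S1, ℂ)) (n : ℤ) :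
    ⟪toL2 f, (fourierLp 2 n : L2S1)⟫_ℂ = starRingEnd ℂ (fourierCoeff (f : S1 → ℂ) n) := by
  rw [← inner_fourierLp_toL2, inner_conj_symm]

lemma hasDerivAt_fourier_S1 (n : ℤ) (t : ℝ) :
    HasDerivAt (fun s : ℝ => fourier n (s : S1)) (Complex.I * n * fourier n (t : S1)) t := by
  have h := hasDerivAt_fourier (2 * π) n t
  convert h using 2
  have : (π : ℂ) ≠ 0 := by exact_mod_cast Real.pi_ne_zero
  push_cast
  field_simp

/-- Integration by parts: differentiation multiplies the `n`-th Fourier coefficient by `i n`. -/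
lemma fourierCoeff_deriv {g g' : C(S1, ℂ)}
    (hg : ∀ t : ℝ, HasDerivAt (fun s : ℝ => g (s : S1)) (g' (t : S1)) t) (n : ℤ) :
    fourierCoeff (g' : S1 → ℂ) n = Complex.I * n * fourierCoeff (g : S1 → ℂ) n := by
  have hc : Continuous fun t : ℝ => fourier (-n) (t : S1) * g' (t : S1) := by fun_prop
  have hc' : Continuous fun t : ℝ => fourier (-n) (t : S1) * g (t : S1) := by fun_prop
  have hd : ∀ t : ℝ, HasDerivAt (fun s : ℝ => fourier (-n) (s : S1) * g (s : S1))
      (-(Complex.I * n) * (fourier (-n) (t : S1) * g (t : S1))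
        + fourier (-n) (t : S1) * g' (t : S1)) t := by
    intro t
    refine ((hasDerivAt_fourier_S1 (-n) t).mul (hg t)).congr_deriv ?_
    push_cast
    ring
  have hci : Continuous fun t : ℝ => -(Complex.I * n) * (fourier (-n) (t : S1) * g (t : S1)) :=
    continuous_const.mul hc'
  have hint := intervalIntegral.integral_eq_sub_of_hasDerivAt (a := 0) (b := 0 + 2 * π)
    (fun t _ => hd t) ((hci.add hc).intervalIntegrable _ _)
  have hper : ((0 + 2 * π : ℝ) : S1) = ((0 : ℝ) : S1) := AddCircle.coe_add_period _ _
  rw [hper, sub_self, intervalIntegral.integral_add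
    (hci.intervalIntegrable _ _) (hc.intervalIntegrable _ _),
    intervalIntegral.integral_const_mul] at hint
  rw [fourierCoeff_eq_intervalIntegral _ n 0, fourierCoeff_eq_intervalIntegral _ n 0]
  simp only [smul_eq_mul, Complex.real_smul]
  linear_combination (((1 / (2 * π) : ℝ)) : ℂ) * hint

lemma fourierLp_mem_diracGraph (n : ℤ) :
    ((fourierLp 2 n : L2S1), (n : ℂ) • (fourierLp 2 n : L2S1)) ∈ diracGraph := by
  intro g g' _ hd
  simp only [inner_smul_right, inner_smul_left, inner_toL2_fourierLp, fourierCoeff_deriv hd,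
    map_mul, map_neg, Complex.conj_I, map_intCast]
  linear_combination ((n : ℂ) * (starRingEnd ℂ) (fourierCoeff (g : S1 → ℂ) n)) * Complex.I_mul_I

lemma inner_fourierLp_of_mem_diracGraph {ψ η : L2S1} (h : (ψ, η) ∈ diracGraph) (n : ℤ) :
    ⟪(fourierLp 2 n : L2S1), η⟫_ℂ = n * ⟪(fourierLp 2 n : L2S1), ψ⟫_ℂ := by
  have hd : ∀ t : ℝ, HasDerivAt (fun s : ℝ => fourier n (s : S1))
      (((Complex.I * n) • fourier n : C(S1, ℂ)) (t : S1)) t := fun t => by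
    simpa using hasDerivAt_fourier_S1 n t
  have h' := h (fourier n) ((Complex.I * n) • fourier n) (fourier_mem_smoothFun n) hd
  rw [map_smul, smul_smul, inner_smul_left] at h'
  refine h'.trans ?_
  congr 1
  simp only [map_mul, map_neg, Complex.conj_I, map_intCast]
  linear_combination (-(n : ℂ)) * Complex.I_mul_I

lemma projN_apply (N : ℕ) (ψ : L2S1) :
    projN N ψ = ∑ n ∈ Finset.Icc (-(N : ℤ)) N,
      ⟪(fourierLp 2 n : L2S1), ψ⟫_ℂ • (fourierLp 2 n : L2S1) := by
  have ho := orthonormal_fourier (T := 2 * π)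
  refine Submodule.eq_starProjection_of_mem_of_inner_eq_zero ?_ ?_
  · refine Submodule.sum_mem _ fun n hn =>
      Submodule.smul_mem _ _ (Submodule.subset_span ⟨n, ?_, rfl⟩)
    simpa using hn
  · intro w hw
    induction hw using Submodule.span_induction with
    | mem w hw =>
      obtain ⟨m, hm, rfl⟩ := hw
      have hm' : m ∈ Finset.Icc (-(N : ℤ)) N := by simpa using hm
      change ⟪_, (fourierLp 2 m : L2S1)⟫_ℂ = 0
      rw [inner_sub_left, ho.inner_left_sum _ hm', inner_conj_symm, sub_self]
    | zero => simp
    | add u v _ _ hu hv => rw [inner_add_right, hu, hv, add_zero]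
    | smul c u _ hu => rw [inner_smul_right, hu, mul_zero]

/-- `P_N` commutes with `D`: it maps the graph of `D` into itself. -/
lemma projN_mem_diracGraph (N : ℕ) {ψ η : L2S1} (h : (ψ, η) ∈ diracGraph) :
    (projN N ψ, projN N η) ∈ diracGraph := by
  have hs : (projN N ψ, projN N η) = ∑ n ∈ Finset.Icc (-(N : ℤ)) N,
      ⟪(fourierLp 2 n : L2S1), ψ⟫_ℂ •
        ((fourierLp 2 n : L2S1), (n : ℂ) • (fourierLp 2 n : L2S1)) := by
    refine Prod.ext ?_ ?_
    · rw [Prod.fst_sum, projN_apply]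
      rfl
    · rw [Prod.snd_sum]
      change projN N η = _
      rw [projN_apply]
      refine Finset.sum_congr rfl fun n _ => ?_
      rw [inner_fourierLp_of_mem_diracGraph h n, Prod.smul_snd, smul_smul, mul_comm (n : ℂ)]
  rw [hs]
  exact Submodule.sum_mem _ fun n _ => Submodule.smul_mem _ _ (fourierLp_mem_diracGraph n)

lemma projN_mem_domain (N : ℕ) (ψ : L2S1) : projN N ψ ∈ circleD.domain := by
  rw [projN_apply]
  exact Submodule.sum_mem _ fun n _ =>
    Submodule.smul_mem _ _ (exists_circleD_eq (fourierLp_mem_diracGraph n)).1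

lemma projN_projN (N : ℕ) (ψ : L2S1) : projN N (projN N ψ) = projN N ψ :=
  Submodule.starProjection_eq_self_iff.2 (Submodule.starProjection_apply_mem _ _)

lemma norm_projN_le (N : ℕ) (ψ : L2S1) : ‖projN N ψ‖ ≤ ‖ψ‖ :=
  Submodule.norm_starProjection_apply_le _ _

lemma inner_projN_left (N : ℕ) (ψ η : L2S1) : ⟪projN N ψ, η⟫_ℂ = ⟪ψ, projN N η⟫_ℂ :=
  Submodule.inner_starProjection_left_eq_right _ _ _

lemma circleD_projN (N : ℕ) (ψ : circleD.domain) :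
    circleD ⟨projN N ψ, projN_mem_domain N ψ⟩ = projN N (circleD ψ) :=
  (exists_circleD_eq (projN_mem_diracGraph N (mem_diracGraph ψ))).2

lemma circleDN_domain (N : ℕ) (ψ : L2S1) : ψ ∈ (circleDN N).domain :=
  projN_mem_domain N ψ

lemma circleDN_apply (N : ℕ) (ψ : (circleDN N).domain) :
    circleDN N ψ = projN N (circleD ⟨projN N ψ, projN_mem_domain N ψ⟩) := rfl

/-- Truncation contracts the commutator seminorm: since `P_N` commutes with `D`,
`[D_N, P_N a P_N] = P_N [D, a] P_N`. -/
lemma commNorm_circleDN_compress_le_one {a : L2S1 →L[ℂ] L2S1} (ha : commNorm circleD a ≤ 1)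
    (N : ℕ) : commNorm (circleDN N) (compress (projN N) a) ≤ 1 := by
  rw [commNorm_le_one_iff] at ha ⊢
  intro ψ
  refine ⟨circleDN_domain N _, ?_⟩
  obtain ⟨h, hle⟩ := ha ⟨projN N ψ, projN_mem_domain N ψ⟩
  have h1 : circleDN N ⟨compress (projN N) a ψ, circleDN_domain N _⟩ =
      projN N (circleD ⟨a (projN N ψ), h⟩) := by
    have hP := circleD_projN N ⟨a (projN N ψ), h⟩
    rw [circleDN_apply, ← projN_projN N (circleD ⟨a (projN N ψ), h⟩), ← hP]
    congr 3
    exact projN_projN N _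
  have h2 : compress (projN N) a (circleDN N ψ) =
      projN N (a (circleD ⟨projN N ψ, projN_mem_domain N ψ⟩)) := by
    have hP := circleD_projN N ⟨projN N ψ, projN_mem_domain N ψ⟩
    simp only [projN_projN] at hP
    change projN N (a (projN N (circleDN N ψ))) = _
    rw [circleDN_apply, projN_projN, ← hP]
  rw [h1, h2, ← map_sub]
  exact (norm_projN_le N _).trans (hle.trans (norm_projN_le N _))

/-- Symmetry of `D`, at the level of its graph. -/
lemma inner_diracGraph_comm {ψ η φ ξ : L2S1} (h : (ψ, η) ∈ diracGraph)
    (h' : (φ, ξ) ∈ diracGraph) : ⟪η, φ⟫_ℂ = ⟪ψ, ξ⟫_ℂ := by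
  rw [← (fourierBasis (T := 2 * π)).tsum_inner_mul_inner η φ,
    ← (fourierBasis (T := 2 * π)).tsum_inner_mul_inner ψ ξ]
  refine tsum_congr fun n => ?_
  rw [coe_fourierBasis, inner_fourierLp_of_mem_diracGraph h' n, ← inner_conj_symm η,
    inner_fourierLp_of_mem_diracGraph h n, map_mul, inner_conj_symm, map_intCast]
  ring

/-! ### Multiplication operators -/

lemma mulRep_apply (f : C(S1, ℂ)) : mulRep f = mulL f := rfl

lemma mulL_toL2 (f g : C(S1, ℂ)) : mulL f (toL2 g) = toL2 (f * g) := by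
  refine MeasureTheory.Lp.ext ?_
  have h1 := ContinuousMap.coeFn_toLp (p := 2) (𝕜 := ℂ) (AddCircle.haarAddCircle (T := 2 * π)) g
  have h2 := ContinuousMap.coeFn_toLp (p := 2) (𝕜 := ℂ)
    (AddCircle.haarAddCircle (T := 2 * π)) (f * g)
  filter_upwards [coeFn_mulL f (toL2 g), h1, h2] with t h h1 h2
  rw [h]
  refine Eq.trans ?_ h2.symm
  rw [ContinuousMap.mul_apply, ← h1]
  rfl

lemma norm_mulL_le (f : C(S1, ℂ)) : ‖mulL f‖ ≤ ‖f‖ :=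
  NonUnitalStarAlgHom.norm_apply_le mulRep f

lemma norm_mulL_apply_le (f : C(S1, ℂ)) (ψ : L2S1) : ‖mulL f ψ‖ ≤ ‖f‖ * ‖ψ‖ :=
  (mulL f).le_of_opNorm_le (norm_mulL_le f) ψ

lemma inner_mulL_left (f : C(S1, ℂ)) (ψ η : L2S1) :
    ⟪mulL f ψ, η⟫_ℂ = ⟪ψ, mulL (star f) η⟫_ℂ := by
  have h : mulL (star f) = ContinuousLinearMap.adjoint (mulL f) := by
    rw [← ContinuousLinearMap.star_eq_adjoint]
    exact map_star mulRep f
  rw [h, ContinuousLinearMap.adjoint_inner_right]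

lemma fourierCoeff_mul_fourier (f : C(S1, ℂ)) (m n : ℤ) :
    fourierCoeff ((f * fourier n : C(S1, ℂ)) : S1 → ℂ) m = fourierCoeff (f : S1 → ℂ) (m - n) := by
  refine MeasureTheory.integral_congr_ae (Filter.Eventually.of_forall fun t => ?_)
  have h : -(m - n) = -m + n := by ring
  simp only [h, fourier_add, ContinuousMap.mul_apply, smul_eq_mul]
  ring

/-! ### The Fejér states as Fejér transforms -/

/-- A sum over `|k| ≤ N`, folded at `0`. -/
lemma sum_Icc_neg_natCast {M : Type*} [AddCommMonoid M] (g : ℤ → M) (N : ℕ) :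
    ∑ k ∈ Finset.Icc (-(N : ℤ)) N, g k =
      g 0 + ∑ k ∈ Finset.Icc 1 N, (g k + g (-(k : ℤ))) := by
  induction N with
  | zero => simp
  | succ N ih =>
    have h : Finset.Icc (-((N + 1 : ℕ) : ℤ)) ((N + 1 : ℕ) : ℤ) =
        insert ((N + 1 : ℕ) : ℤ) (insert (-((N + 1 : ℕ) : ℤ)) (Finset.Icc (-(N : ℤ)) N)) := by
      ext k
      simp only [Finset.mem_insert, Finset.mem_Icc]
      omega
    rw [h, Finset.sum_insert, Finset.sum_insert, ih, Finset.sum_Icc_succ_top (by omega)]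
    · abel
    · simp
    · simp only [Finset.mem_insert, Finset.mem_Icc]
      omega

/-- A Toeplitz double sum, collected along its diagonals. -/
lemma sum_range_sum_range_sub (F : ℤ → ℂ) (N : ℕ) :
    ∑ m ∈ Finset.range (N + 1), ∑ n ∈ Finset.range (N + 1), F ((m : ℤ) - n) =
      ∑ k ∈ Finset.Icc (-(N : ℤ)) N, ((N : ℂ) + 1 - (|(k : ℝ)| : ℝ)) * F k := by
  rw [sum_Icc_neg_natCast]
  induction N with
  | zero => simp
  | succ N ih =>
    rw [Finset.sum_range_succ]
    -- The last column and the last row contribute the diagonals `k < 0` and `k > 0`.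
    simp only [Finset.sum_range_succ (fun n => F (_ - ((n : ℕ) : ℤ))) (N + 1)]
    rw [Finset.sum_add_distrib, ih, Finset.sum_Icc_succ_top (by omega : 1 ≤ N + 1)]
    have h1 : ∑ m ∈ Finset.range (N + 1), F ((m : ℤ) - ((N + 1 : ℕ) : ℤ)) =
        ∑ k ∈ Finset.Icc 1 (N + 1), F (-(k : ℤ)) := by
      rw [← Finset.sum_range_reflect, Finset.range_eq_Ico, Finset.sum_Ico_eq_sum_range,
        ← Finset.Ico_succ_right_eq_Icc, Finset.sum_Ico_eq_sum_range]
      refine Finset.sum_congr (by simp) fun k hk => ?_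
      have := Finset.mem_range.1 hk
      congr 1
      simp at this ⊢
      omega
    have h2 : ∑ n ∈ Finset.range (N + 1), F (((N + 1 : ℕ) : ℤ) - n) =
        ∑ k ∈ Finset.Icc 1 (N + 1), F k := by
      rw [← Finset.sum_range_reflect, Finset.range_eq_Ico, Finset.sum_Ico_eq_sum_range,
        ← Finset.Ico_succ_right_eq_Icc, Finset.sum_Ico_eq_sum_range]
      refine Finset.sum_congr (by simp) fun k hk => ?_
      have := Finset.mem_range.1 hk
      congr 1
      simp at this ⊢
      omega
    rw [h1, h2, Finset.sum_Icc_succ_top (by omega : 1 ≤ N + 1),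
      Finset.sum_Icc_succ_top (by omega : 1 ≤ N + 1)]
    have h3 : ∑ k ∈ Finset.Icc 1 N, ((((N + 1 : ℕ) : ℂ) + 1 - (|((k : ℤ) : ℝ)| : ℝ)) * F k +
        (((N + 1 : ℕ) : ℂ) + 1 - (|((-(k : ℤ) : ℤ) : ℝ)| : ℝ)) * F (-(k : ℤ))) =
        ∑ k ∈ Finset.Icc 1 N, (((N : ℂ) + 1 - (|((k : ℤ) : ℝ)| : ℝ)) * F k +
          ((N : ℂ) + 1 - (|((-(k : ℤ) : ℤ) : ℝ)| : ℝ)) * F (-(k : ℤ))) +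
        ∑ k ∈ Finset.Icc 1 N, F k + ∑ k ∈ Finset.Icc 1 N, F (-(k : ℤ)) := by
      rw [← Finset.sum_add_distrib, ← Finset.sum_add_distrib]
      refine Finset.sum_congr rfl fun k _ => ?_
      push_cast
      ring
    have h4 : |(((N + 1 : ℕ) : ℤ) : ℝ)| = (N : ℝ) + 1 := by
      push_cast
      exact abs_of_nonneg (by positivity)
    have h5 : |((-((N + 1 : ℕ) : ℤ) : ℤ) : ℝ)| = (N : ℝ) + 1 := by
      rw [Int.cast_neg, abs_neg, h4]
    rw [h3, h4, h5]
    push_cast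
    simp only [abs_zero, Complex.ofReal_zero, sub_self]
    ring

/-- The vector functional of `fejerVec x N` is the Fejér transform at `x`, for every continuous
function. -/
lemma inner_fejerVec_mulL (x : S1) (N : ℕ) (f : C(S1, ℂ)) :
    ⟪fejerVec x N, mulL f (fejerVec x N)⟫_ℂ = fejerTransform N f x := by
  have hpos : (0 : ℝ) < (N : ℝ) + 1 := by positivity
  have hsq : ((1 / √((N : ℝ) + 1) : ℝ) : ℂ) * ((1 / √((N : ℝ) + 1) : ℝ) : ℂ)
      = 1 / ((N : ℂ) + 1) := by
    rw [← Complex.ofReal_mul, div_mul_div_comm, Real.mul_self_sqrt hpos.le]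
    push_cast
    ring
  have hne : (N : ℂ) + 1 ≠ 0 := by exact_mod_cast hpos.ne'
  have hterm : ∀ m n : ℕ, ⟪fourier (-(m : ℤ)) x • (fourierLp 2 (m : ℤ) : L2S1),
      fourier (-(n : ℤ)) x • mulL f (fourierLp 2 (n : ℤ) : L2S1)⟫_ℂ =
      fourierCoeff (f : S1 → ℂ) ((m : ℤ) - n) * fourier ((m : ℤ) - n) x := by
    intro m n
    have h1 : mulL f (fourierLp 2 (n : ℤ)) = toL2 (f * fourier n) := mulL_toL2 f (fourier n)
    rw [inner_smul_left, inner_smul_right, ← fourier_neg, neg_neg, h1, inner_fourierLp_toL2,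
      fourierCoeff_mul_fourier, sub_eq_add_neg (m : ℤ), fourier_add]
    ring
  rw [fejerVec, map_smul, inner_smul_left, inner_smul_right, Complex.conj_ofReal, ← mul_assoc, hsq,
    map_sum, sum_inner]
  simp only [inner_sum, map_smul, hterm]
  rw [sum_range_sum_range_sub (fun k => fourierCoeff (f : S1 → ℂ) k * fourier k x),
    fejerTransform, Finset.mul_sum]
  refine Finset.sum_congr rfl fun k _ => ?_
  push_cast
  field_simp

lemma circleSharp_fejerState (x : S1) (N : ℕ) (a : saPart circleAlg) :
    (circleSharp (fejerState x N)).toLin a =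
      (⟪fejerVec x N, (a : L2S1 →L[ℂ] L2S1) (fejerVec x N)⟫_ℂ).re := by
  change (⟪fejerVec x N, projN N ((a : L2S1 →L[ℂ] L2S1) (projN N (fejerVec x N)))⟫_ℂ).re = _
  rw [← inner_projN_left, projN_fejerVec]

lemma fejerTransform_conj {f : C(S1, ℂ)} (hf : star f = f) (N : ℕ) (x : S1) :
    starRingEnd ℂ (fejerTransform N f x) = fejerTransform N f x := by
  rw [← inner_fejerVec_mulL, inner_conj_symm, inner_mulL_left, hf]

lemma norm_fejerTransform_le (N : ℕ) (f : C(S1, ℂ)) (x : S1) : ‖fejerTransform N f x‖ ≤ ‖f‖ := by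
  rw [← inner_fejerVec_mulL]
  refine (norm_inner_le_norm _ _).trans ?_
  simpa [norm_fejerVec] using norm_mulL_apply_le f (fejerVec x N)

lemma fejerTransform_sub (N : ℕ) (f g : C(S1, ℂ)) (x : S1) :
    fejerTransform N (f - g) x = fejerTransform N f x - fejerTransform N g x := by
  have h : mulL (f - g) = mulL f - mulL g := map_sub mulRep f g
  simp only [← inner_fejerVec_mulL, h, sub_apply, inner_sub_right]

lemma fejerTransform_add (N : ℕ) (f g : C(S1, ℂ)) (x : S1) :
    fejerTransform N (f + g) x = fejerTransform N f x + fejerTransform N g x := by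
  have h : mulL (f + g) = mulL f + mulL g := map_add mulRep f g
  simp only [← inner_fejerVec_mulL, h, add_apply, inner_add_right]

lemma fejerTransform_smul (N : ℕ) (c : ℂ) (f : C(S1, ℂ)) (x : S1) :
    fejerTransform N (c • f) x = c * fejerTransform N f x := by
  have h : mulL (c • f) = c • mulL f := map_smul mulRep c f
  simp only [← inner_fejerVec_mulL, h, smul_apply, inner_smul_right]

/-! ### The upper bound by the geodesic distance -/

lemma fejerVec_mem_domain (x : S1) (N : ℕ) : fejerVec x N ∈ circleD.domain := by
  rw [← projN_fejerVec]
  exact projN_mem_domain N _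

lemma circleD_fejerVec (x : S1) (N : ℕ) :
    circleD ⟨fejerVec x N, fejerVec_mem_domain x N⟩ =
      ((1 / √((N : ℝ) + 1) : ℝ) : ℂ) •
        ∑ n ∈ Finset.range (N + 1),
          fourier (-(n : ℤ)) x • ((n : ℤ) : ℂ) • (fourierLp 2 (n : ℤ) : L2S1) := by
  refine (exists_circleD_eq (ψ := fejerVec x N) ?_).2
  have h : (fejerVec x N, ((1 / √((N : ℝ) + 1) : ℝ) : ℂ) •
        ∑ n ∈ Finset.range (N + 1),
          fourier (-(n : ℤ)) x • ((n : ℤ) : ℂ) • (fourierLp 2 (n : ℤ) : L2S1)) =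
      ((1 / √((N : ℝ) + 1) : ℝ) : ℂ) • ∑ n ∈ Finset.range (N + 1), fourier (-(n : ℤ)) x •
        ((fourierLp 2 (n : ℤ) : L2S1), ((n : ℤ) : ℂ) • (fourierLp 2 (n : ℤ) : L2S1)) := by
    refine Prod.ext ?_ ?_
    · rw [Prod.smul_fst, Prod.fst_sum]
      rfl
    · rw [Prod.smul_snd, Prod.snd_sum]
      rfl
  rw [h]
  exact Submodule.smul_mem _ _ (Submodule.sum_mem _ fun n _ =>
    Submodule.smul_mem _ _ (fourierLp_mem_diracGraph n))

/-- The vectors `fejerVec t N` are the orbit of `fejerVec 0 N` under the translation group, whose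
generator is `-i D`. -/
lemma hasDerivAt_fejerVec (N : ℕ) (t : ℝ) :
    HasDerivAt (fun s : ℝ => fejerVec (s : S1) N)
      ((-Complex.I) • circleD ⟨fejerVec (t : S1) N, fejerVec_mem_domain _ N⟩) t := by
  have h := (HasDerivAt.fun_sum (u := Finset.range (N + 1)) fun n _ =>
    (hasDerivAt_fourier_S1 (-(n : ℤ)) t).smul_const (fourierLp 2 (n : ℤ) : L2S1)).const_smul
      ((1 / √((N : ℝ) + 1) : ℝ) : ℂ)
  refine h.congr_deriv ?_
  rw [circleD_fejerVec, smul_comm (-Complex.I), Finset.smul_sum (r := -Complex.I)]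
  congr 1
  refine Finset.sum_congr rfl fun n _ => ?_
  rw [smul_smul, smul_smul]
  congr 1
  push_cast
  ring

lemma circleDN_fejerVec (x : S1) (N : ℕ) :
    circleDN N ⟨fejerVec x N, circleDN_domain N _⟩ =
      circleD ⟨fejerVec x N, fejerVec_mem_domain x N⟩ := by
  have h := circleD_projN N ⟨fejerVec x N, fejerVec_mem_domain x N⟩
  simp only [projN_fejerVec] at h
  rw [circleDN_apply]
  simp only [projN_fejerVec]
  exact h.symm

/-- `d/dt ⟨ψ_t, b ψ_t⟩ = i ⟨ψ_t, [D_N, b] ψ_t⟩`, which is bounded by `‖[D_N, b]‖`. -/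
lemma norm_inner_fejerVec_sub_le {b : L2S1 →L[ℂ] L2S1} {N : ℕ}
    (hb : commNorm (circleDN N) b ≤ 1) (s t : ℝ) :
    ‖⟪fejerVec (s : S1) N, b (fejerVec (s : S1) N)⟫_ℂ -
      ⟪fejerVec (t : S1) N, b (fejerVec (t : S1) N)⟫_ℂ‖ ≤ |s - t| := by
  rw [commNorm_le_one_iff] at hb
  have hd : ∀ u : ℝ, ∃ d : ℂ, ‖d‖ ≤ 1 ∧
      HasDerivAt (fun u : ℝ => ⟪fejerVec (u : S1) N, b (fejerVec (u : S1) N)⟫_ℂ) d u := by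
    intro u
    set ψ := fejerVec (u : S1) N with hψ
    set η := circleD ⟨fejerVec (u : S1) N, fejerVec_mem_domain _ N⟩ with hη
    have h1 := hasDerivAt_fejerVec N u
    have h2 : HasDerivAt (fun s : ℝ => b (fejerVec (s : S1) N)) (b ((-Complex.I) • η)) u :=
      (b.restrictScalars ℝ).hasFDerivAt.comp_hasDerivAt u h1
    refine ⟨_, ?_, h1.inner ℂ h2⟩
    obtain ⟨h, hle⟩ := hb ⟨ψ, circleDN_domain N _⟩
    rw [circleDN_fejerVec] at hle
    have hPη : projN N η = η := by
      have h := circleDN_fejerVec (u : S1) N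
      rw [circleDN_apply] at h
      rw [hη, ← h, projN_projN]
    have hsymm : ⟪ψ, circleDN N ⟨b ψ, h⟩⟫_ℂ = ⟪η, b ψ⟫_ℂ := by
      rw [circleDN_apply, ← inner_projN_left, projN_fejerVec,
        ← inner_diracGraph_comm (mem_diracGraph ⟨fejerVec (u : S1) N, fejerVec_mem_domain _ N⟩)
          (mem_diracGraph ⟨projN N (b ψ), projN_mem_domain N _⟩)]
      change ⟪η, projN N (b ψ)⟫_ℂ = _
      rw [← inner_projN_left, hPη]
    have hcomm : ⟪ψ, b ((-Complex.I) • η)⟫_ℂ + ⟪(-Complex.I) • η, b ψ⟫_ℂ =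
        Complex.I * ⟪ψ, circleDN N ⟨b ψ, h⟩ - b η⟫_ℂ := by
      rw [inner_sub_right, hsymm, map_smul, inner_smul_right, inner_smul_left, map_neg,
        Complex.conj_I]
      ring
    change ‖⟪ψ, b ((-Complex.I) • η)⟫_ℂ + ⟪(-Complex.I) • η, b ψ⟫_ℂ‖ ≤ 1
    rw [hcomm, norm_mul, Complex.norm_I, one_mul]
    refine (norm_inner_le_norm _ _).trans ?_
    rw [norm_fejerVec, one_mul]
    exact hle.trans (norm_fejerVec _ _).le
  choose d hd1 hd2 using hd
  have h := Convex.norm_image_sub_le_of_norm_hasDerivWithin_le (s := Set.univ) (C := 1) (x := t)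
    (y := s) (fun u _ => (hd2 u).hasDerivWithinAt) (fun u _ => hd1 u) convex_univ
    (Set.mem_univ _) (Set.mem_univ _)
  simpa using h

lemma exists_coe_eq_and_abs_sub_eq_dist (x y : ℝ) :
    ∃ t : ℝ, (t : S1) = (y : S1) ∧ |x - t| = dist (x : S1) (y : S1) := by
  refine ⟨y + round ((2 * π)⁻¹ * (x - y)) * (2 * π), ?_, ?_⟩
  · rw [← zsmul_eq_mul, AddCircle.coe_add, AddCircle.coe_zsmul, AddCircle.coe_period, smul_zero,
      add_zero]
  · rw [dist_eq_norm, ← AddCircle.coe_sub, AddCircle.norm_eq]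
    congr 1
    ring

lemma distON_le_dist (x y : ℝ) (N : ℕ) :
    distON (fejerState (x : S1) N) (fejerState (y : S1) N) ≤
      ((dist (x : S1) (y : S1) : ℝ) : EReal) := by
  refine stateDist_le_of_forall fun b hb => ?_
  obtain ⟨t, ht, hdist⟩ := exists_coe_eq_and_abs_sub_eq_dist x y
  have h := norm_inner_fejerVec_sub_le hb x t
  rw [ht, hdist] at h
  refine le_trans ?_ h
  change (⟪fejerVec (x : S1) N, (b : L2S1 →L[ℂ] L2S1) (fejerVec (x : S1) N)⟫_ℂ).re -
    (⟪fejerVec (y : S1) N, (b : L2S1 →L[ℂ] L2S1) (fejerVec (y : S1) N)⟫_ℂ).re ≤ _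
  rw [← Complex.sub_re]
  exact Complex.re_le_norm _

lemma distFlat_le_distON {N : ℕ} (φ φ' : OUState (circleO N) (circleOUnit N)) :
    distFlat φ φ' ≤ distON φ φ' :=
  iSup₂_le fun a ha => le_stateDist φ φ' (truncMap (projN N) (saPart circleAlg) a)
    (commNorm_circleDN_compress_le_one ha N)

/-! ### Commutators with multiplication operators -/

lemma inner_mulL_right (f : C(S1, ℂ)) (ψ η : L2S1) :
    ⟪ψ, mulL f η⟫_ℂ = ⟪mulL (star f) ψ, η⟫_ℂ := by
  rw [inner_mulL_left, star_star]

lemma mulRep_mem_saPart {f : C(S1, ℂ)} (hf : f ∈ smoothFun) (hs : star f = f) :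
    mulRep f ∈ saPart circleAlg :=
  ⟨⟨f, hf, rfl⟩, IsSelfAdjoint.map (f := mulRep) hs⟩

/-- The Leibniz rule `D (g ψ) = g D ψ - i g' ψ`. -/
lemma mulL_mem_diracGraph {g g' : C(S1, ℂ)} (hg : g ∈ smoothFun)
    (hd : ∀ t : ℝ, HasDerivAt (fun s : ℝ => g (s : S1)) (g' (t : S1)) t) {ψ η : L2S1}
    (h : (ψ, η) ∈ diracGraph) :
    (mulL g ψ, mulL g η + mulL ((-Complex.I) • g') ψ) ∈ diracGraph := by
  intro k k' hk hk'
  have hgd : ∀ t : ℝ, HasDerivAt (fun s : ℝ => (star g * k : C(S1, ℂ)) (s : S1))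
      ((star g' * k + star g * k' : C(S1, ℂ)) (t : S1)) t := fun t =>
    (hd t).star.mul (hk' t)
  have h1 := h (star g * k) (star g' * k + star g * k')
    (smoothFun.mul_mem (smoothFun.star_mem' hg) hk) hgd
  have h2 : star ((-Complex.I) • g') = Complex.I • star g' := by
    rw [star_smul]
    simp
  simp only [inner_add_right, inner_mulL_right, mulL_toL2, h2] at h1 ⊢
  rw [h1, map_smul, mulL_toL2, smul_mul_assoc, map_smul, map_add, smul_add, inner_add_left,
    inner_smul_left, inner_smul_left, inner_smul_left]
  simp only [map_neg, Complex.conj_I]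
  ring

/-- `‖[D, g]‖ ≤ ‖g'‖_∞`. -/
lemma commNorm_mulL_le_one {g g' : C(S1, ℂ)} (hg : g ∈ smoothFun)
    (hd : ∀ t : ℝ, HasDerivAt (fun s : ℝ => g (s : S1)) (g' (t : S1)) t) (hn : ‖g'‖ ≤ 1) :
    commNorm circleD (mulL g) ≤ 1 := by
  rw [commNorm_le_one_iff]
  intro ψ
  obtain ⟨h, heq⟩ := exists_circleD_eq (mulL_mem_diracGraph hg hd (mem_diracGraph ψ))
  refine ⟨h, ?_⟩
  rw [heq, add_sub_cancel_left]
  refine (norm_mulL_apply_le _ _).trans ?_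
  rw [norm_smul, norm_neg, Complex.norm_I, one_mul]
  exact mul_le_of_le_one_left (norm_nonneg _) hn

/-! ### Fejér means of Lipschitz functions -/

/-- Fejér transforms commute with translations. -/
lemma fejerTransform_comp_add (N : ℕ) (f : C(S1, ℂ)) (h x : S1) :
    fejerTransform N (f.comp (ContinuousMap.addRight h)) x = fejerTransform N f (x + h) := by
  refine Finset.sum_congr rfl fun n _ => ?_
  have hmul : ∀ t : S1, fourier n (t + h) = (fourier n t * fourier n h : ℂ) := fun t => by
    simp only [fourier_apply, smul_add, AddCircle.toCircle_add, Circle.coe_mul]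
  have hc : fourierCoeff ((f.comp (ContinuousMap.addRight h) : C(S1, ℂ)) : S1 → ℂ) n =
      fourier n h * fourierCoeff (f : S1 → ℂ) n := by
    rw [fourierCoeff, fourierCoeff, ← MeasureTheory.integral_add_right_eq_self
        (fun t : S1 => fourier (-n) t • f t) h,
      ← MeasureTheory.integral_const_mul]
    refine MeasureTheory.integral_congr_ae (Filter.Eventually.of_forall fun t => ?_)
    have h1 : (fourier n h : ℂ) * fourier (-n) h = 1 := by
      rw [← fourier_add, add_neg_cancel, fourier_zero]
    have hmul' : (fourier (-n) (t + h) : ℂ) = fourier (-n) t * fourier (-n) h := by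
      simp only [fourier_apply, smul_add, AddCircle.toCircle_add, Circle.coe_mul]
    simp only [ContinuousMap.comp_apply, ContinuousMap.coe_addRight, smul_eq_mul, hmul']
    linear_combination (-(fourier (-n) t * f (t + h))) * h1
  rw [hc, hmul]
  ring

/-- The Fejér mean of `f`, as a trigonometric polynomial. -/
noncomputable def fejerPoly (N : ℕ) (f : C(S1, ℂ)) : C(S1, ℂ) :=
  ∑ n ∈ Finset.Icc (-(N : ℤ)) N,
    (((1 - |(n : ℝ)| / ((N : ℝ) + 1) : ℝ) : ℂ) * fourierCoeff (f : S1 → ℂ) n) • fourier n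

lemma fejerPoly_apply (N : ℕ) (f : C(S1, ℂ)) (x : S1) :
    fejerPoly N f x = fejerTransform N f x := by
  simp [fejerPoly, fejerTransform, ContinuousMap.sum_apply]

lemma fejerPoly_mem_smoothFun (N : ℕ) (f : C(S1, ℂ)) : fejerPoly N f ∈ smoothFun :=
  sum_mem fun n _ => SMulMemClass.smul_mem _ (fourier_mem_smoothFun n)

lemma star_fejerPoly {f : C(S1, ℂ)} (hf : star f = f) (N : ℕ) :
    star (fejerPoly N f) = fejerPoly N f := by
  ext x
  rw [ContinuousMap.star_apply, fejerPoly_apply]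
  exact fejerTransform_conj hf N x

/-- Fejér means do not increase Lipschitz constants. -/
lemma lipschitzWith_fejerPoly {f : C(S1, ℂ)} (hf : LipschitzWith 1 f) (N : ℕ) :
    LipschitzWith 1 (fejerPoly N f) := by
  refine LipschitzWith.of_dist_le_mul fun x y => ?_
  have hx : x = y + (x - y) := by abel
  rw [fejerPoly_apply, fejerPoly_apply, dist_eq_norm]
  nth_rewrite 1 [hx]
  rw [← fejerTransform_comp_add, ← fejerTransform_sub]
  refine (norm_fejerTransform_le _ _ _).trans ?_
  rw [ContinuousMap.norm_le _ (by positivity)]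
  intro t
  have h := hf.dist_le_mul (t + (x - y)) t
  rw [dist_eq_norm, dist_eq_norm, add_sub_cancel_left, ← dist_eq_norm x] at h
  exact h

lemma exists_hasDerivAt_fejerPoly (N : ℕ) (f : C(S1, ℂ)) :
    ∃ g' : C(S1, ℂ),
      ∀ t : ℝ, HasDerivAt (fun s : ℝ => fejerPoly N f (s : S1)) (g' (t : S1)) t := by
  refine ⟨∑ n ∈ Finset.Icc (-(N : ℤ)) N,
    (((1 - |(n : ℝ)| / ((N : ℝ) + 1) : ℝ) : ℂ) * fourierCoeff (f : S1 → ℂ) n) •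
      (Complex.I * n) • fourier n, fun t => ?_⟩
  simp only [fejerPoly, ContinuousMap.sum_apply, ContinuousMap.smul_apply, smul_eq_mul]
  exact HasDerivAt.fun_sum fun n _ => (hasDerivAt_fourier_S1 n t).const_mul _

lemma commNorm_fejerPoly_le_one {f : C(S1, ℂ)} (hf : LipschitzWith 1 f) (N : ℕ) :
    commNorm circleD (mulL (fejerPoly N f)) ≤ 1 := by
  obtain ⟨g', hg'⟩ := exists_hasDerivAt_fejerPoly N f
  refine commNorm_mulL_le_one (fejerPoly_mem_smoothFun N f) hg' ?_
  rw [ContinuousMap.norm_le _ zero_le_one]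
  intro x
  induction x using QuotientAddGroup.induction_on with
  | H t =>
    have hcoe : LipschitzWith 1 (fun s : ℝ => (s : S1)) := by
      refine LipschitzWith.of_dist_le_mul fun s u => ?_
      rw [dist_eq_norm, dist_eq_norm, ← AddCircle.coe_sub, NNReal.coe_one, one_mul]
      exact QuotientAddGroup.norm_mk_le_norm
    have hlip := (lipschitzWith_fejerPoly hf N).comp hcoe
    have h := norm_deriv_le_of_lipschitz (x₀ := t) hlip
    have hd : deriv ((fejerPoly N f : S1 → ℂ) ∘ fun s : ℝ => (s : S1)) t = g' (t : S1) :=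
      (hg' t).deriv
    rw [hd] at h
    simpa using h

lemma tendsto_fejer_weight (n : ℤ) :
    Filter.Tendsto (fun N : ℕ => ((1 - |(n : ℝ)| / ((N : ℝ) + 1) : ℝ) : ℂ)) Filter.atTop
      (nhds 1) := by
  have h : Filter.Tendsto (fun N : ℕ => (|(n : ℝ)| / ((N : ℝ) + 1))) Filter.atTop (nhds 0) :=
    Filter.Tendsto.const_div_atTop
      (Filter.tendsto_atTop_add_const_right _ _ tendsto_natCast_atTop_atTop) _
  have h' := h.const_sub 1
  rw [sub_zero] at h'
  exact (Complex.continuous_ofReal.tendsto _).comp h'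

lemma fourierCoeff_fejerPoly {N : ℕ} {n : ℤ} (hn : |n| ≤ N) (f : C(S1, ℂ)) :
    fourierCoeff (fejerPoly N f : S1 → ℂ) n =
      ((1 - |(n : ℝ)| / ((N : ℝ) + 1) : ℝ) : ℂ) * fourierCoeff (f : S1 → ℂ) n := by
  rw [← inner_fourierLp_toL2, fejerPoly, map_sum]
  simp only [map_smul]
  exact (orthonormal_fourier (T := 2 * π)).inner_right_sum _
    (Finset.mem_Icc.2 (abs_le.1 hn))

lemma tendsto_fejerTransform_fejerPoly (N : ℕ) (f : C(S1, ℂ)) (x : S1) :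
    Filter.Tendsto (fun M : ℕ => fejerTransform N (fejerPoly M f) x) Filter.atTop
      (nhds (fejerTransform N f x)) := by
  refine tendsto_finsetSum _ fun n _ => Filter.Tendsto.mul_const _ (Filter.Tendsto.const_mul _ ?_)
  have h := (tendsto_fejer_weight n).mul_const (fourierCoeff (f : S1 → ℂ) n)
  rw [one_mul] at h
  refine h.congr' ?_
  filter_upwards [Filter.eventually_ge_atTop n.natAbs] with M hM
  have hM' : |n| ≤ M := by
    rw [Int.abs_eq_natAbs]
    exact_mod_cast hM
  exact (fourierCoeff_fejerPoly hM' f).symm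

/-- Fejér's theorem, pointwise: it holds for the characters, which span a dense subspace, and the
Fejér transforms are equicontinuous. -/
lemma tendsto_fejerTransform (f : C(S1, ℂ)) (x : S1) :
    Filter.Tendsto (fun N : ℕ => fejerTransform N f x) Filter.atTop (nhds (f x)) := by
  have hlip : ∀ N : ℕ, LipschitzWith 1 (fun g : C(S1, ℂ) => fejerTransform N g x) := fun N =>
    LipschitzWith.of_dist_le_mul fun g k => by
      rw [dist_eq_norm, dist_eq_norm, ← fejerTransform_sub, NNReal.coe_one, one_mul]
      exact norm_fejerTransform_le N _ x
  have heq := (LipschitzWith.uniformEquicontinuous _ 1 hlip).equicontinuous f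
  refine heq.tendsto_of_mem_closure (f := fun g : C(S1, ℂ) => g x)
    (s := (Submodule.span ℂ (Set.range (fourier (T := 2 * π))) : Set C(S1, ℂ))) ?_ ?_ ?_
  · exact (ContinuousEvalConst.continuous_eval_const x).continuousWithinAt
  · intro g hg
    induction hg using Submodule.span_induction with
    | mem g hg =>
      obtain ⟨k, rfl⟩ := hg
      have h := (tendsto_fejer_weight k).mul_const (fourier k x : ℂ)
      rw [one_mul] at h
      refine h.congr' ?_
      filter_upwards [Filter.eventually_ge_atTop k.natAbs] with N hN
      have hk : k ∈ Finset.Icc (-(N : ℤ)) N := by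
        rw [Finset.mem_Icc]
        omega
      rw [fejerTransform, Finset.sum_eq_single_of_mem k hk]
      · rw [fourierCoeff_fourier, Pi.single_eq_same, mul_one]
      · intro m _ hm
        rw [fourierCoeff_fourier, Pi.single_eq_of_ne hm, mul_zero, zero_mul]
    | zero => simp [fejerTransform, fourierCoeff]
    | add u v _ _ hu hv => simpa only [fejerTransform_add, ContinuousMap.add_apply] using hu.add hv
    | smul c u _ hu =>
      simp only [fejerTransform_smul, ContinuousMap.smul_apply, smul_eq_mul]
      exact hu.const_mul c
  · rw [← Submodule.topologicalClosure_coe, span_fourier_closure_eq_top]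
    exact Set.mem_univ f

/-! ### Lower bounds by Lipschitz test functions -/

/-- A real `1`-Lipschitz function `f` need not be smooth, but its Fejér means are admissible in the
supremum that defines the distance. -/
lemma fejerTransform_sub_le_distFlat {f : C(S1, ℂ)} (hs : star f = f) (hf : LipschitzWith 1 f)
    (N : ℕ) (x y : S1) :
    (((fejerTransform N f x).re - (fejerTransform N f y).re : ℝ) : EReal) ≤
      distFlat (fejerState x N) (fejerState y N) := by
  have hlim : Filter.Tendsto (fun M : ℕ => (((fejerTransform N (fejerPoly M f) x).re -
      (fejerTransform N (fejerPoly M f) y).re : ℝ) : EReal)) Filter.atTop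
      (nhds (((fejerTransform N f x).re - (fejerTransform N f y).re : ℝ) : EReal)) :=
    (continuous_coe_real_ereal.tendsto _).comp
      (((Complex.continuous_re.tendsto _).comp (tendsto_fejerTransform_fejerPoly N f x)).sub
        ((Complex.continuous_re.tendsto _).comp (tendsto_fejerTransform_fejerPoly N f y)))
  refine le_of_tendsto' hlim fun M => ?_
  have h := le_stateDist (L := commNorm circleD) (circleSharp (fejerState x N))
    (circleSharp (fejerState y N))
    ⟨mulRep (fejerPoly M f),
      mulRep_mem_saPart (fejerPoly_mem_smoothFun M f) (star_fejerPoly hs M)⟩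
    (commNorm_fejerPoly_le_one hf M)
  rw [circleSharp_fejerState, circleSharp_fejerState] at h
  simp only [mulRep_apply, inner_fejerVec_mulL] at h
  exact h

/-- The geodesic distance to `c`, as a complex valued continuous function. -/
noncomputable def distFun (c : S1) : C(S1, ℂ) where
  toFun t := ((dist t c : ℝ) : ℂ)
  continuous_toFun := by fun_prop

lemma star_distFun (c : S1) : star (distFun c) = distFun c := by
  ext t
  exact Complex.conj_ofReal _

lemma lipschitzWith_distFun (c : S1) : LipschitzWith 1 (distFun c) :=
  LipschitzWith.of_dist_le_mul fun s t => by
    change dist ((dist s c : ℝ) : ℂ) ((dist t c : ℝ) : ℂ) ≤ _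
    rw [Complex.dist_eq, ← Complex.ofReal_sub, Complex.norm_real, NNReal.coe_one, one_mul,
      Real.norm_eq_abs]
    exact abs_dist_sub_le s t c

lemma tendsto_distFlat (x y : ℝ) :
    Filter.Tendsto (fun N : ℕ => distFlat (fejerState (x : S1) N) (fejerState (y : S1) N))
      Filter.atTop (nhds ((dist (x : S1) (y : S1) : ℝ) : EReal)) := by
  have hlim : Filter.Tendsto (fun N : ℕ => (((fejerTransform N (distFun y) (x : S1)).re -
      (fejerTransform N (distFun y) (y : S1)).re : ℝ) : EReal)) Filter.atTop
      (nhds (((distFun y (x : S1)).re - (distFun y (y : S1)).re : ℝ) : EReal)) :=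
    (continuous_coe_real_ereal.tendsto _).comp
      (((Complex.continuous_re.tendsto _).comp (tendsto_fejerTransform _ _)).sub
        ((Complex.continuous_re.tendsto _).comp (tendsto_fejerTransform _ _)))
  have hval : (distFun y (x : S1)).re - (distFun y (y : S1)).re = dist (x : S1) (y : S1) := by
    simp [distFun]
  rw [hval] at hlim
  refine tendsto_of_tendsto_of_tendsto_of_le_of_le hlim tendsto_const_nhds (fun N => ?_) fun N => ?_
  · exact fejerTransform_sub_le_distFlat (star_distFun _) (lipschitzWith_distFun _) N _ _
  · exact (distFlat_le_distON _ _).trans (distON_le_dist x y N)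

/-! ### The triangle wave and the lower bound by a sine sum -/

lemma fourier_coe_eq_exp (n : ℤ) (t : ℝ) :
    (fourier n (t : S1) : ℂ) = Complex.exp (Complex.I * (n * t : ℝ)) := by
  rw [fourier_coe_apply]
  congr 1
  have : (π : ℂ) ≠ 0 := by exact_mod_cast Real.pi_ne_zero
  push_cast
  field_simp

lemma fourier_add_fourier_neg (n : ℤ) (t : ℝ) :
    (fourier n (t : S1) : ℂ) + fourier (-n) (t : S1) = (2 * Real.cos (n * t) : ℝ) := by
  rw [fourier_neg, fourier_coe_eq_exp, Complex.add_conj, mul_comm Complex.I,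
    Complex.exp_ofReal_mul_I_re]

lemma norm_fourier_sub_fourier (n : ℤ) (x y : ℝ) :
    ‖(fourier n (x : S1) : ℂ) - fourier n (y : S1)‖ = 2 * |Real.sin (n * (x - y) / 2)| := by
  have h : (fourier n (x : S1) : ℂ) - fourier n (y : S1) =
      fourier n (y : S1) * (Complex.exp (Complex.I * (n * (x - y) : ℝ)) - 1) := by
    rw [← fourier_coe_eq_exp, mul_sub, mul_one, fourier_coe_eq_exp, fourier_coe_eq_exp,
      fourier_coe_eq_exp, ← Complex.exp_add]
    congr 2
    push_cast
    ring
  rw [h, norm_mul, Complex.norm_exp_I_mul_ofReal_sub_one, norm_mul, fourier_apply, Circle.norm_coe]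
  simp

lemma fourier_natCast_pi (n : ℕ) : (fourier (n : ℤ) ((π : ℝ) : S1) : ℂ) = (-1) ^ n := by
  rw [fourier_coe_eq_exp, ← Complex.exp_pi_mul_I, ← Complex.exp_nat_mul]
  congr 1
  push_cast
  ring

lemma distFun_zero_coe {t : ℝ} (ht : |t| ≤ π) : distFun 0 (t : S1) = ((|t| : ℝ) : ℂ) := by
  change ((dist (t : S1) 0 : ℝ) : ℂ) = _
  rw [dist_zero_right, (AddCircle.norm_coe_eq_abs_iff (2 * π) Real.two_pi_pos.ne').2]
  rw [abs_of_pos Real.two_pi_pos]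
  linarith

/-- The Fourier coefficients of the triangle wave `t ↦ |t|` on `[-π, π]`. -/
lemma fourierCoeff_distFun_zero {n : ℤ} (hn : n ≠ 0) :
    fourierCoeff (distFun 0 : S1 → ℂ) n =
      (fourier (-n) ((π : ℝ) : S1) - 1) / (π * (n : ℂ) ^ 2) := by
  have hπ : (π : ℂ) ≠ 0 := by exact_mod_cast Real.pi_ne_zero
  have hn' : (n : ℂ) ≠ 0 := by exact_mod_cast hn
  -- `(i t / n + 1 / n²) e^{-int}` is a primitive of `t e^{-int}`.
  set G : ℝ → ℂ := fun t =>
    (Complex.I * t / n + 1 / (n : ℂ) ^ 2) * fourier (-n) (t : S1) with hG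
  have hd : ∀ t : ℝ, HasDerivAt G (t * fourier (-n) (t : S1)) t := by
    intro t
    have h1 : HasDerivAt (fun s : ℝ => Complex.I * (s : ℂ) / n + 1 / (n : ℂ) ^ 2)
        (Complex.I / n) t := by
      have := (((hasDerivAt_id t).ofReal_comp.const_mul Complex.I).div_const (n : ℂ)).add_const
        (1 / (n : ℂ) ^ 2)
      simpa using this
    refine (h1.mul (hasDerivAt_fourier_S1 (-n) t)).congr_deriv ?_
    push_cast
    field_simp
    linear_combination (-(t : ℂ) * n) * Complex.I_sq
  have hc : Continuous fun t : ℝ => (t : ℂ) * fourier (-n) (t : S1) := by fun_prop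
  have hc' : Continuous fun t : ℝ => (fourier (-n) (t : S1) : ℂ) * distFun 0 (t : S1) := by fun_prop
  have hpos : ∫ t in (0 : ℝ)..π, (fourier (-n) (t : S1) : ℂ) * distFun 0 (t : S1) = G π - G 0 := by
    rw [← intervalIntegral.integral_eq_sub_of_hasDerivAt (fun t _ => hd t)
      (hc.intervalIntegrable _ _)]
    refine intervalIntegral.integral_congr fun t ht => ?_
    rw [Set.uIcc_of_le Real.pi_pos.le] at ht
    rw [distFun_zero_coe (abs_le.2 ⟨by linarith [ht.1, Real.pi_pos], ht.2⟩), abs_of_nonneg ht.1,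
      mul_comm]
  have hneg : ∫ t in (-π)..0, (fourier (-n) (t : S1) : ℂ) * distFun 0 (t : S1) =
      -(G 0 - G (-π)) := by
    rw [← intervalIntegral.integral_eq_sub_of_hasDerivAt (fun t _ => hd t)
      (hc.intervalIntegrable _ _), ← intervalIntegral.integral_neg]
    refine intervalIntegral.integral_congr fun t ht => ?_
    rw [Set.uIcc_of_le (by linarith [Real.pi_pos])] at ht
    rw [distFun_zero_coe (abs_le.2 ⟨ht.1, by linarith [ht.2, Real.pi_pos]⟩), abs_of_nonpos ht.2]
    push_cast
    ring
  have hper : ((-π : ℝ) : S1) = ((π : ℝ) : S1) := by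
    rw [← AddCircle.coe_add_period (2 * π) (-π)]
    congr 1
    ring
  have hend : -π + 2 * π = π := by ring
  rw [fourierCoeff_eq_intervalIntegral _ n (-π), hend]
  simp only [smul_eq_mul, Complex.real_smul]
  rw [← intervalIntegral.integral_add_adjacent_intervals (b := 0) (hc'.intervalIntegrable _ _)
    (hc'.intervalIntegrable _ _), hneg, hpos, hG]
  simp only [hper, QuotientAddGroup.mk_zero, fourier_eval_zero]
  push_cast
  field_simp
  ring

/-- The Fejér transform of the triangle wave as a cosine sum. -/
lemma fejerTransform_distFun_zero_re (N : ℕ) (t : ℝ) :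
    (fejerTransform N (distFun 0) (t : S1)).re =
      (fourierCoeff (distFun 0 : S1 → ℂ) 0).re + ∑ n ∈ Finset.Icc 1 N,
        (1 - (n : ℝ) / ((N : ℝ) + 1)) * (((-1) ^ n - 1) / (π * (n : ℝ) ^ 2)) *
          (2 * Real.cos (n * t)) := by
  have h : fejerTransform N (distFun 0) (t : S1) =
      fourierCoeff (distFun 0 : S1 → ℂ) 0 + ((∑ n ∈ Finset.Icc 1 N,
        (1 - (n : ℝ) / ((N : ℝ) + 1)) * (((-1) ^ n - 1) / (π * (n : ℝ) ^ 2)) *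
          (2 * Real.cos (n * t)) : ℝ) : ℂ) := by
    rw [fejerTransform, sum_Icc_neg_natCast, Complex.ofReal_sum]
    congr 1
    · simp
    · refine Finset.sum_congr rfl fun n hn => ?_
      have hn0 : (n : ℤ) ≠ 0 := by
        have := (Finset.mem_Icc.1 hn).1
        omega
      have hc := fourier_add_fourier_neg (n : ℤ) t
      have h1 : (fourier (-(n : ℤ)) ((π : ℝ) : S1) : ℂ) = (-1) ^ n := by
        rw [fourier_neg, fourier_natCast_pi]
        simp
      rw [fourierCoeff_distFun_zero hn0, fourierCoeff_distFun_zero (neg_ne_zero.2 hn0), neg_neg,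
        fourier_natCast_pi, h1]
      rw [Int.cast_natCast] at hc
      rw [Complex.ofReal_mul, ← hc]
      simp only [Int.cast_neg, abs_neg, Int.cast_natCast, Nat.abs_cast]
      push_cast
      ring
  rw [h, Complex.add_re, Complex.ofReal_re]

/-- The test function is the distance to `(x + y - π) / 2`, the triangle wave one of whose edges has
its middle at `(x + y) / 2`; seen from there it is odd up to a constant, so that only the sines of
`n (x - y) / 2` with odd `n` survive. -/
lemma rhoLower_le_distFlat (x y : ℝ) (N : ℕ) :
    ((rhoLower N (x - y) : ℝ) : EReal) ≤
      distFlat (fejerState (x : S1) N) (fejerState (y : S1) N) := by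
  have hshift : ∀ c t : ℝ, fejerTransform N (distFun (c : S1)) (t : S1) =
      fejerTransform N (distFun 0) ((t - c : ℝ) : S1) := by
    intro c t
    have hf : distFun (c : S1) = (distFun 0).comp (ContinuousMap.addRight (-(c : S1))) := by
      ext u
      change ((dist u (c : S1) : ℝ) : ℂ) = ((dist (u + -(c : S1)) 0 : ℝ) : ℂ)
      rw [dist_zero_right, dist_eq_norm, sub_eq_add_neg]
    rw [hf, fejerTransform_comp_add, AddCircle.coe_sub, sub_eq_add_neg]
  refine le_trans (le_of_eq ?_) (fejerTransform_sub_le_distFlat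
    (star_distFun (((x + y) / 2 - π / 2 : ℝ) : S1)) (lipschitzWith_distFun _) N _ _)
  rw [hshift, hshift, fejerTransform_distFun_zero_re, fejerTransform_distFun_zero_re,
    add_sub_add_left_eq_sub, ← Finset.sum_sub_distrib, rhoLower, Finset.sum_filter,
    Finset.mul_sum]
  congr 1
  refine Finset.sum_congr rfl fun n hn => ?_
  have hn0 : (n : ℝ) ≠ 0 := by
    have := (Finset.mem_Icc.1 hn).1
    positivity
  have hπ := Real.pi_ne_zero
  have hcos : Real.cos (n * (x - ((x + y) / 2 - π / 2))) -
      Real.cos (n * (y - ((x + y) / 2 - π / 2))) =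
      -2 * Real.sin (n * (π / 2)) * Real.sin (n * (x - y) / 2) := by
    rw [Real.cos_sub_cos]
    congr 2
    · congr 2
      ring
    · ring
  rw [← mul_sub, ← mul_sub, hcos]
  split_ifs with hodd
  · obtain ⟨k, rfl⟩ := hodd
    have hsin : Real.sin (((2 * k + 1 : ℕ) : ℝ) * (π / 2)) = (-1) ^ k := by
      have h : ((2 * k + 1 : ℕ) : ℝ) * (π / 2) = π / 2 + k * π := by
        push_cast
        ring
      rw [h, Real.sin_add_nat_mul_pi, Real.sin_pi_div_two, mul_one]
    have hk : (2 * k + 1 - 1) / 2 = k := by omega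
    have hpow : (-1 : ℝ) ^ (2 * k + 1) = -1 := by
      rw [pow_succ, pow_mul]
      simp
    rw [hsin, hk, hpow]
    field_simp
    ring
  · rw [Nat.not_odd_iff_even] at hodd
    rw [hodd.neg_one_pow]
    simp

/-! ### The upper bound by Cauchy–Schwarz -/

/-- Applying `[D, f]` to the constant function `1` bounds the `L²` norm of `f'`, and Bessel's
inequality bounds its Fourier coefficients. -/
lemma sum_sq_norm_fourierCoeff_le {f : C(S1, ℂ)} (hf : commNorm circleD (mulL f) ≤ 1)
    (s : Finset ℤ) : ∑ n ∈ s, (|(n : ℝ)| * ‖fourierCoeff (f : S1 → ℂ) n‖) ^ 2 ≤ 1 := by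
  rw [commNorm_le_one_iff] at hf
  obtain ⟨h0, h0'⟩ := exists_circleD_eq (fourierLp_mem_diracGraph 0)
  obtain ⟨h, hle⟩ := hf ⟨_, h0⟩
  rw [h0', Int.cast_zero, zero_smul, map_zero, sub_zero,
    (orthonormal_fourier (T := 2 * π)).1 0] at hle
  have hmem := mem_diracGraph ⟨_, h⟩
  have h1 : mulL f (fourierLp 2 0) = toL2 f := by
    have h2 := mulL_toL2 f (fourier 0)
    have h3 : (fourier 0 : C(S1, ℂ)) = 1 := by
      ext t
      exact fourier_zero
    rw [h3, mul_one] at h2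
    rw [← h2, ← h3]
    rfl
  have hb := (orthonormal_fourier (T := 2 * π)).sum_inner_products_le
    (circleD ⟨mulL f (fourierLp 2 0), h⟩) (s := s)
  refine le_trans (le_of_eq (Finset.sum_congr rfl fun n _ => ?_)) (hb.trans ?_)
  · rw [inner_fourierLp_of_mem_diracGraph hmem n]
    change _ = ‖(n : ℂ) * ⟪fourierLp 2 n, mulL f (fourierLp 2 0)⟫_ℂ‖ ^ 2
    rw [h1, inner_fourierLp_toL2, norm_mul, Complex.norm_intCast]
  · exact pow_le_one₀ (norm_nonneg _) hle

/-- Cauchy–Schwarz, with the weights `|n| |f_n|` split off; the factor `2 √2 = √8` comes from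
`|e^{inx} - e^{iny}| = 2 |sin (n (x - y) / 2)|` and from the two signs of `n`. -/
lemma fejerTransform_sub_le_rhoUpper {f : C(S1, ℂ)} (hf : commNorm circleD (mulL f) ≤ 1)
    (N : ℕ) (x y : ℝ) :
    ‖fejerTransform N f (x : S1) - fejerTransform N f (y : S1)‖ ≤ rhoUpper N (x - y) := by
  -- At `n = 0` the junk value `1 / 0 = 0` is harmless, as that term vanishes anyway.
  set v : ℤ → ℝ := fun n => 1 / |(n : ℝ)| * |1 - |(n : ℝ)| / ((N : ℝ) + 1)| *
    (2 * |Real.sin (n * (x - y) / 2)|) with hv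
  have hsum : ∑ n ∈ Finset.Icc (-(N : ℤ)) N, v n ^ 2 =
      8 * ∑ n ∈ Finset.Icc 1 N, 1 / (n : ℝ) ^ 2 * (1 - (n : ℝ) / ((N : ℝ) + 1)) ^ 2 *
        Real.sin ((n : ℝ) * (x - y) / 2) ^ 2 := by
    rw [sum_Icc_neg_natCast, Finset.mul_sum]
    have h0 : v 0 ^ 2 = 0 := by simp [hv]
    rw [h0, zero_add]
    refine Finset.sum_congr rfl fun n _ => ?_
    have hneg : v (-(n : ℤ)) = v n := by
      simp only [hv, Int.cast_neg, abs_neg, neg_mul, neg_div, Real.sin_neg]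
    rw [hneg]
    simp only [hv, Int.cast_natCast, Nat.abs_cast, mul_pow, sq_abs, div_pow, one_pow]
    ring
  have hterm : ∀ n : ℤ, ‖((1 - |(n : ℝ)| / ((N : ℝ) + 1) : ℝ) : ℂ) *
      fourierCoeff (f : S1 → ℂ) n * fourier n (x : S1) -
      ((1 - |(n : ℝ)| / ((N : ℝ) + 1) : ℝ) : ℂ) *
      fourierCoeff (f : S1 → ℂ) n * fourier n (y : S1)‖ =
      |(n : ℝ)| * ‖fourierCoeff (f : S1 → ℂ) n‖ * v n := by
    intro n
    rw [← mul_sub, norm_mul, norm_mul, norm_fourier_sub_fourier, Complex.norm_real,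
      Real.norm_eq_abs]
    rcases eq_or_ne n 0 with rfl | hn
    · simp
    · have hn' : |(n : ℝ)| ≠ 0 := abs_ne_zero.2 (by exact_mod_cast hn)
      simp only [hv]
      field_simp
  have hS : 0 ≤ ∑ n ∈ Finset.Icc 1 N, 1 / (n : ℝ) ^ 2 * (1 - (n : ℝ) / ((N : ℝ) + 1)) ^ 2 *
        Real.sin ((n : ℝ) * (x - y) / 2) ^ 2 :=
    Finset.sum_nonneg fun n _ => by positivity
  calc ‖fejerTransform N f (x : S1) - fejerTransform N f (y : S1)‖
      ≤ ∑ n ∈ Finset.Icc (-(N : ℤ)) N, |(n : ℝ)| * ‖fourierCoeff (f : S1 → ℂ) n‖ * v n := by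
        rw [fejerTransform, fejerTransform, ← Finset.sum_sub_distrib]
        exact (norm_sum_le _ _).trans_eq (Finset.sum_congr rfl fun n _ => hterm n)
    _ ≤ √(∑ n ∈ Finset.Icc (-(N : ℤ)) N, (|(n : ℝ)| * ‖fourierCoeff (f : S1 → ℂ) n‖) ^ 2) *
          √(∑ n ∈ Finset.Icc (-(N : ℤ)) N, v n ^ 2) := Real.sum_mul_le_sqrt_mul_sqrt _ _ _
    _ ≤ 1 * √(∑ n ∈ Finset.Icc (-(N : ℤ)) N, v n ^ 2) :=
        mul_le_mul_of_nonneg_right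
          (Real.sqrt_le_one.2 (sum_sq_norm_fourierCoeff_le hf _)) (Real.sqrt_nonneg _)
    _ = rhoUpper N (x - y) := by
        have h8 : √8 = 2 * √2 := by
          rw [show (8 : ℝ) = 2 ^ 2 * 2 by norm_num, Real.sqrt_mul (by norm_num),
            Real.sqrt_sq (by norm_num)]
        rw [one_mul, hsum, Real.sqrt_mul (by norm_num), h8, rhoUpper]

lemma distFlat_le_rhoUpper (x y : ℝ) (N : ℕ) :
    distFlat (fejerState (x : S1) N) (fejerState (y : S1) N) ≤
      ((rhoUpper N (x - y) : ℝ) : EReal) := by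
  refine stateDist_le_of_forall fun a ha => ?_
  obtain ⟨f, -, hfa⟩ := a.2.1
  have hfa' : mulL f = a := hfa
  rw [← hfa'] at ha
  rw [circleSharp_fejerState, circleSharp_fejerState, ← hfa', inner_fejerVec_mulL,
    inner_fejerVec_mulL, ← Complex.sub_re]
  exact (Complex.re_le_norm _).trans (fejerTransform_sub_le_rhoUpper ha N x y)

lemma circleSharp_fejerState_mulRep (x : S1) (N : ℕ) (f : C(S1, ℂ))
    (hf : mulRep f ∈ saPart circleAlg) :
    (((circleSharp (fejerState x N)).toLin ⟨mulRep f, hf⟩ : ℝ) : ℂ) = fejerTransform N f x := by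
  rw [circleSharp_fejerState]
  have hre : starRingEnd ℂ ⟪fejerVec x N, mulL f (fejerVec x N)⟫_ℂ =
      ⟪fejerVec x N, mulL f (fejerVec x N)⟫_ℂ := by
    rw [inner_conj_symm, ← ContinuousLinearMap.adjoint_inner_right]
    have h : ContinuousLinearMap.adjoint (mulL f) = mulL f := hf.2
    rw [h]
  rw [← inner_fejerVec_mulL]
  exact Complex.conj_eq_iff_re.1 hre

end SpectralCutoff

theorem mainTheorem10 (x y : ℝ) :
    (∀ (N : ℕ) (f : C(S1, ℂ)) (hf : mulRep f ∈ saPart circleAlg),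
      (((circleSharp (fejerState (x : S1) N)).toLin ⟨mulRep f, hf⟩ : ℝ) : ℂ) =
        fejerTransform N f (x : S1)) ∧
    (∀ N : ℕ,
      distFlat (fejerState (x : S1) N) (fejerState (y : S1) N) ≤
        distON (fejerState (x : S1) N) (fejerState (y : S1) N) ∧
      distON (fejerState (x : S1) N) (fejerState (y : S1) N) ≤
        ((dist (x : S1) (y : S1) : ℝ) : EReal)) ∧
    Filter.Tendsto (fun N : ℕ => distFlat (fejerState (x : S1) N) (fejerState (y : S1) N))
      Filter.atTop (nhds ((dist (x : S1) (y : S1) : ℝ) : EReal)) ∧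
    Filter.Tendsto (fun N : ℕ => distON (fejerState (x : S1) N) (fejerState (y : S1) N))
      Filter.atTop (nhds ((dist (x : S1) (y : S1) : ℝ) : EReal)) ∧
    (∀ N : ℕ,
      ((rhoLower N (x - y) : ℝ) : EReal) ≤
        distFlat (fejerState (x : S1) N) (fejerState (y : S1) N) ∧
      distFlat (fejerState (x : S1) N) (fejerState (y : S1) N) ≤
        ((rhoUpper N (x - y) : ℝ) : EReal)) :=
  ⟨fun N f hf => circleSharp_fejerState_mulRep _ N f hf,
    fun N => ⟨distFlat_le_distON _ _, distON_le_dist x y N⟩,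
    tendsto_distFlat x y,
    tendsto_of_tendsto_of_tendsto_of_le_of_le (tendsto_distFlat x y) tendsto_const_nhds
      (fun _ => distFlat_le_distON _ _) (fun N => distON_le_dist x y N),
    fun N => ⟨rhoLower_le_distFlat x y N, distFlat_le_rhoUpper x y N⟩⟩
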